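/- All groups are finite. A class of groups is closed under isomorphism. A non-empty class $\mathfrak F$ is called a formation if (a) $G\in\mathfrak F$ and $N\trianglelefteq G$ imply $G/N\in\mathfrak F$, and (b) $A,B\trianglelefteq H$ with $H/A\in\mathfrak F$ and $H/B\in\mathfrak F$ imply $H/(A\cap B)\in\mathfrak F$. It is hereditary if every subgroup of a group in $\mathfrak F$ is in $\mathfrak F$, and saturated if $G/\Phi(G)\in\mathfrak F$ implies $G\in\mathfrak F$, where $\Phi(G)$ is the Frattini subgroup. Let $\pi(\mathfrak F)$ be the set of primes that divide the order of some group in $\mathfrak F$. For a set $\pi$ of primes let $\pi'$ be its complement in the set of all primes, and let $\mathrm O^{\pi}(G)$ be the smallest normal subgroup $N$ of $G$ such that all prime divisors of $|G/N|$ lie in $\pi$. An $\mathfrak F$-maximal subgroup of $G$ is a subgroup that is maximal under inclusion among the subgroups of $G$ belonging to $\mathfrak F$. Let $\mathrm{Int}_{\mathfrak F}(G)$ be the intersection of all $\mathfrak F$-maximal subgroups of $G$, and $\mathrm{NI}_{\mathfrak F}(G)$ the intersection of the normalizers in $G$ of all $\mathfrak F$-maximal subgroups of $G$. **Proposition 1.**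 Let $\mathfrak F$ be a (non-empty) hereditary saturated formation and $\pi=\pi(\mathfrak F)$. Then $$\mathrm O^{\pi'}(\mathrm{NI}_{\mathfrak F}(G))=\mathrm{Int}_{\mathfrak F}(G)$$ for every finite group $G$. In particular, if $\pi(\mathfrak F)$ is the set of all primes, then $\mathrm{NI}_{\mathfrak F}(G)=\mathrm{Int}_{\mathfrak F}(G)$ for every finite group $G$. -/

import Mathlib

universe u

/-- A class of finite groups: a property of groups that implies finiteness and is invariant
under isomorphism. -/
structure FiniteGroupClass where
  /-- Membership of a group in the class. -/
  Mem : (G : Type u) → [Group G] → Prop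
  finite_of_mem : ∀ {G : Type u} [Group G], Mem G → Finite G
  mem_of_mulEquiv : ∀ {G H : Type u} [Group G] [Group H], (G ≃* H) → Mem G → Mem H

/-- `G` is a `π`-group: every prime divisor of the order of `G` lies in `π`. -/
def IsPiGroup (π : Set ℕ) (G : Type u) [Group G] : Prop :=
  ∀ p : ℕ, p.Prime → p ∣ Nat.card G → p ∈ π

/-- The complement `π'` of `π` in the set of all primes. -/
def primeCompl (π : Set ℕ) : Set ℕ := {p | p.Prime ∧ p ∉ π}

/-- `O^π(G)`: the intersection of all normal subgroups `N` of `G` such that `G ⧸ N` is a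
`π`-group. For finite `G` it is the smallest such subgroup, see `isLeast_piResidual`. -/
def piResidual (π : Set ℕ) (G : Type u) [Group G] : Subgroup G :=
  sInf {N : Subgroup G | ∃ _ : N.Normal, IsPiGroup π (G ⧸ N)}

theorem isLeast_piResidual (π : Set ℕ) (G : Type u) [Group G] [Finite G] :
    IsLeast {N : Subgroup G | ∃ _ : N.Normal, IsPiGroup π (G ⧸ N)} (piResidual π G) := by
  have hfin : {N : Subgroup G | ∃ _ : N.Normal, IsPiGroup π (G ⧸ N)}.Finite := Set.toFinite _
  refine ⟨?_, fun N hN => sInf_le hN⟩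
  have key : ∀ S : Set (Subgroup G), S.Finite →
      S ⊆ {N : Subgroup G | ∃ _ : N.Normal, IsPiGroup π (G ⧸ N)} →
      sInf S ∈ {N : Subgroup G | ∃ _ : N.Normal, IsPiGroup π (G ⧸ N)} := by
    intro S hS
    induction S, hS using Set.Finite.induction_on with
    | empty =>
      intro _
      rw [sInf_empty]
      refine ⟨inferInstance, fun p hp hd => ?_⟩
      have h1 : Nat.card (G ⧸ (⊤ : Subgroup G)) = 1 := Subgroup.index_top
      rw [h1] at hd
      exact absurd (Nat.dvd_one.mp hd) hp.one_lt.ne'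
    | @insert A T _ _ ih =>
      intro hsub
      obtain ⟨hA, hAp⟩ := hsub (Set.mem_insert A T)
      obtain ⟨hB, hBp⟩ := ih ((Set.subset_insert A T).trans hsub)
      rw [sInf_insert]
      refine ⟨inferInstance, fun p hp hd => ?_⟩
      have h1 : (A ⊓ sInf T).relIndex (sInf T) * (sInf T).index = (A ⊓ sInf T).index :=
        Subgroup.relIndex_mul_index inf_le_right
      have h2 : p ∣ (A ⊓ sInf T).index := hd
      rw [← h1, Subgroup.inf_relIndex_right] at h2
      rcases (Nat.Prime.dvd_mul hp).mp h2 with h | h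
      · exact hAp p hp (h.trans (Subgroup.relIndex_dvd_index_of_normal A (sInf T)))
      · exact hBp p hp h
  exact key _ hfin subset_rfl

namespace FiniteGroupClass

/-- `𝔉` is a formation: closed under quotients, and `H ⧸ A ∈ 𝔉`, `H ⧸ B ∈ 𝔉` imply
`H ⧸ (A ⊓ B) ∈ 𝔉`. -/
structure IsFormation (𝔉 : FiniteGroupClass.{u}) : Prop where
  quotient : ∀ (G : Type u) [Group G] (N : Subgroup G) [N.Normal], 𝔉.Mem G → 𝔉.Mem (G ⧸ N)
  quotient_inf : ∀ (H : Type u) [Group H] [Finite H] (A B : Subgroup H) [A.Normal] [B.Normal],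
    𝔉.Mem (H ⧸ A) → 𝔉.Mem (H ⧸ B) → 𝔉.Mem (H ⧸ (A ⊓ B))

/-- `𝔛` is hereditary: closed under subgroups. -/
def IsHereditary (𝔛 : FiniteGroupClass.{u}) : Prop :=
  ∀ (G : Type u) [Group G] (H : Subgroup G), 𝔛.Mem G → 𝔛.Mem H

/-- `𝔛` is saturated: a finite group `G` with `G ⧸ Φ(G) ∈ 𝔛` lies in `𝔛`. -/
def IsSaturated (𝔛 : FiniteGroupClass.{u}) : Prop :=
  ∀ (G : Type u) [Group G] [Finite G], 𝔛.Mem (G ⧸ frattini G) → 𝔛.Mem G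

/-- `π(𝔛)`: the primes dividing the order of some group in `𝔛`. -/
def primes (𝔛 : FiniteGroupClass.{u}) : Set ℕ :=
  {p | p.Prime ∧ ∃ (G : Type u) (_ : Group G), 𝔛.Mem G ∧ p ∣ Nat.card G}

/-- `M` is an `𝔛`-maximal subgroup of `G`: it is maximal under inclusion among the subgroups
of `G` that belong to `𝔛`. -/
def IsMaximalSubgroup (𝔛 : FiniteGroupClass.{u}) {G : Type u} [Group G] (M : Subgroup G) : Prop :=
  Maximal (fun H : Subgroup G => 𝔛.Mem H) M

/-- `Int_𝔛(G)`: the intersection of all `𝔛`-maximal subgroups of `G`. -/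
def maxInter (𝔛 : FiniteGroupClass.{u}) (G : Type u) [Group G] : Subgroup G :=
  ⨅ (M : Subgroup G) (_ : 𝔛.IsMaximalSubgroup M), M

/-- `NI_𝔛(G)`: the intersection of the normalizers of all `𝔛`-maximal subgroups of `G`. -/
def normalizerInter (𝔛 : FiniteGroupClass.{u}) (G : Type u) [Group G] : Subgroup G :=
  ⨅ (M : Subgroup G) (_ : 𝔛.IsMaximalSubgroup M), Subgroup.normalizer (M : Set G)

end FiniteGroupClass

/-!
Let `N` be the intersection of the normalizers of the `𝔉`-maximal subgroups of `G`, let `I` be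
the intersection of these subgroups, and let `π = π(𝔉)`. The heart of the proof is
`FiniteGroupClass.mem_of_map_normalizerInter`: a `π`-subgroup `S` of `G` belongs to `𝔉` as soon as
its image in `G ⧸ N` does. By induction all proper subgroups of `S` belong to `𝔉`. If `S` does not,
then a maximal subgroup `L` of `S` has the form `S ∩ M` with `M` an `𝔉`-maximal subgroup of `G`, so
`S ∩ N` normalizes `L`; by maximality either `S ∩ N ≤ L` or `L` is normal in `S`. Now
`S ⧸ (S ∩ N)` belongs to `𝔉`, and so does `S ⧸ L` for every normal maximal subgroup `L`, because it
has prime order in `π`. Since `Φ(S)` contains the intersection of all these normal subgroups,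
`S ⧸ Φ(S)` belongs to `𝔉`, and saturation puts `S` in `𝔉`.

For an `𝔉`-maximal subgroup `M` and a `p`-subgroup `P` of `N` with `p ∈ π`, the product `M P` is a
`π`-group with the same image in `G ⧸ N` as `M`. So `M P` belongs to `𝔉`, and `P ≤ M`. Thus `I`
contains the Sylow `p`-subgroups of `N` for all `p ∈ π`, so `N ⧸ I` is a `π'`-group and
`O^{π'}(N) ≤ I`. The other inclusion holds because `I` is a `π`-group.
-/

theorem IsPiGroup.mono {π : Set ℕ} {G : Type u} [Group G] {H K : Subgroup G} (hHK : H ≤ K)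
    (hK : IsPiGroup π K) : IsPiGroup π H :=
  fun p hp hd => hK p hp (hd.trans (Subgroup.card_dvd_of_le hHK))

/-- If a subgroup `H` normalizes a subgroup `K`, then `K ⊔ H` is the product `K H`, and its order
divides the product of the orders. -/
theorem Subgroup.card_sup_dvd_of_le_normalizer {G : Type*} [Group G] {H K : Subgroup G}
    (h : H ≤ Subgroup.normalizer (K : Set G)) :
    Nat.card (K ⊔ H : Subgroup G) ∣ Nat.card K * Nat.card H := by
  have := Subgroup.normal_subgroupOf_of_le_normalizer h
  have := Subgroup.normal_subgroupOf_sup_of_le_normalizer h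
  have h1 : K.relIndex H = K.relIndex (H ⊔ K) :=
    Nat.card_congr (QuotientGroup.quotientInfEquivProdNormalizerQuotient H K h).toEquiv
  rw [sup_comm, ← Subgroup.card_mul_index (K.subgroupOf (H ⊔ K)),
    Nat.card_congr (Subgroup.subgroupOfEquivOfLe (le_sup_right : K ≤ H ⊔ K)).toEquiv]
  refine mul_dvd_mul_left _ ?_
  change K.relIndex (H ⊔ K) ∣ Nat.card H
  rw [← h1]
  exact Subgroup.index_dvd_card (K.subgroupOf H)

namespace FiniteGroupClass

variable {𝔉 : FiniteGroupClass.{u}} {G : Type u} [Group G]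

theorem IsHereditary.mem_of_le (hher : 𝔉.IsHereditary) {H K : Subgroup G} (hHK : H ≤ K)
    (hK : 𝔉.Mem K) : 𝔉.Mem H :=
  𝔉.mem_of_mulEquiv (Subgroup.subgroupOfEquivOfLe hHK) (hher K (H.subgroupOf K) hK)

theorem IsFormation.mem_of_surjective (hform : 𝔉.IsFormation) {H : Type u} [Group H]
    (f : G →* H) (hf : Function.Surjective f) (hG : 𝔉.Mem G) : 𝔉.Mem H :=
  𝔉.mem_of_mulEquiv (QuotientGroup.quotientKerEquivOfSurjective f hf) (hform.quotient G f.ker hG)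

theorem IsFormation.mem_map (hform : 𝔉.IsFormation) {H : Type u} [Group H] (f : G →* H)
    {K : Subgroup G} (hK : 𝔉.Mem K) : 𝔉.Mem (K.map f) :=
  hform.mem_of_surjective (f.subgroupMap K) (f.subgroupMap_surjective K) hK

theorem mem_of_subsingleton (hne : ∃ (E : Type u) (_ : Group E), 𝔉.Mem E)
    (hher : 𝔉.IsHereditary) [Subsingleton G] : 𝔉.Mem G := by
  obtain ⟨E, _, hE⟩ := hne
  have : Unique G := uniqueOfSubsingleton 1
  exact 𝔉.mem_of_mulEquiv (MulEquiv.ofUnique : (⊥ : Subgroup E) ≃* G) (hher E ⊥ hE)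

/-- A non-empty hereditary class contains the groups of prime order `p` for all `p ∈ π(𝔉)`: by
Cauchy's theorem they occur as subgroups of groups in the class. -/
theorem mem_of_card_prime (hher : 𝔉.IsHereditary) {p : ℕ} (hp : p ∈ 𝔉.primes)
    (hG : Nat.card G = p) : 𝔉.Mem G := by
  obtain ⟨hp, E, _, hE, hd⟩ := hp
  have : Fact p.Prime := ⟨hp⟩
  have : Finite E := 𝔉.finite_of_mem hE
  obtain ⟨x, hx⟩ := exists_prime_orderOf_dvd_card' p hd
  exact 𝔉.mem_of_mulEquiv (mulEquivOfPrimeCardEq ((Nat.card_zpowers x).trans hx) hG)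
    (hher E (Subgroup.zpowers x) hE)

/-- The quotient by a normal maximal subgroup has no proper non-trivial subgroups, so it has prime
order. -/
theorem mem_quotient_of_isCoatom (hher : 𝔉.IsHereditary) [Finite G]
    (hG : IsPiGroup 𝔉.primes G) (L : Subgroup G) [L.Normal] (hL : IsCoatom L) :
    𝔉.Mem (G ⧸ L) := by
  have hcard : Nat.card (G ⧸ L) ≠ 1 := fun h => hL.1 (Subgroup.index_eq_one.mp h)
  obtain ⟨p, hp, hd⟩ := Nat.exists_prime_and_dvd hcard
  have : Fact p.Prime := ⟨hp⟩
  obtain ⟨x, hx⟩ := exists_prime_orderOf_dvd_card' p hd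
  have htop : Subgroup.zpowers x = ⊤ := by
    have hle : L ≤ (Subgroup.zpowers x).comap (QuotientGroup.mk' L) :=
      QuotientGroup.le_comap_mk' L _
    have hsurj := QuotientGroup.mk'_surjective L
    rcases hL.le_iff.mp hle with h | h
    · rw [← Subgroup.map_comap_eq_self_of_surjective hsurj (Subgroup.zpowers x), h,
        Subgroup.map_top_of_surjective _ hsurj]
    · have h1 : Subgroup.zpowers x = ⊥ := by
        rw [← Subgroup.map_comap_eq_self_of_surjective hsurj (Subgroup.zpowers x), h,
          QuotientGroup.map_mk'_self]
      rw [Subgroup.zpowers_eq_bot] at h1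
      rw [h1, orderOf_one] at hx
      exact absurd hx.symm hp.ne_one
  refine mem_of_card_prime hher (hG p hp (hd.trans (Subgroup.card_quotient_dvd_card L))) ?_
  rw [← hx, ← Nat.card_zpowers, htop, Subgroup.card_top]

theorem IsFormation.mem_quotient_of_le (hform : 𝔉.IsFormation) (A B : Subgroup G) [A.Normal]
    [B.Normal] (hAB : A ≤ B) (hA : 𝔉.Mem (G ⧸ A)) : 𝔉.Mem (G ⧸ B) :=
  hform.mem_of_surjective (QuotientGroup.map A B (MonoidHom.id G) hAB)
    (QuotientGroup.map_surjective_of_surjective A B (MonoidHom.id G)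
      (QuotientGroup.mk'_surjective B) hAB) hA

theorem IsFormation.exists_mem_quotient_sInf (hne : ∃ (E : Type u) (_ : Group E), 𝔉.Mem E)
    (hform : 𝔉.IsFormation) (hher : 𝔉.IsHereditary) [Finite G] (T : Set (Subgroup G))
    (hT : ∀ K ∈ T, ∃ _ : K.Normal, 𝔉.Mem (G ⧸ K)) :
    ∃ _ : (sInf T).Normal, 𝔉.Mem (G ⧸ sInf T) := by
  have hfin : T.Finite := Set.toFinite T
  induction T, hfin using Set.Finite.induction_on with
  | empty =>
    rw [sInf_empty]
    have : Subsingleton (G ⧸ (⊤ : Subgroup G)) := QuotientGroup.subsingleton_quotient_top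
    exact ⟨inferInstance, mem_of_subsingleton hne hher⟩
  | @insert A T _ _ ih =>
    obtain ⟨_, hA⟩ := hT A (Set.mem_insert A T)
    obtain ⟨_, hB⟩ := ih fun K hK => hT K (Set.mem_insert_of_mem A hK)
    rw [sInf_insert]
    exact ⟨inferInstance, hform.quotient_inf G A (sInf T) hA hB⟩

/-- A `π(𝔉)`-group `G` belongs to `𝔉` if it has a normal subgroup `A` with `G ⧸ A ∈ 𝔉` such that
every maximal subgroup of `G` is normal or contains `A`: the Frattini subgroup then contains the
intersection of all normal subgroups `K` with `G ⧸ K ∈ 𝔉`. -/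
theorem mem_of_forall_isCoatom (hne : ∃ (E : Type u) (_ : Group E), 𝔉.Mem E)
    (hform : 𝔉.IsFormation) (hher : 𝔉.IsHereditary) (hsat : 𝔉.IsSaturated) [Finite G]
    (hG : IsPiGroup 𝔉.primes G) (A : Subgroup G) [A.Normal] (hA : 𝔉.Mem (G ⧸ A))
    (h : ∀ L : Subgroup G, IsCoatom L → A ≤ L ∨ L.Normal) : 𝔉.Mem G := by
  let T : Set (Subgroup G) := {K | ∃ _ : K.Normal, 𝔉.Mem (G ⧸ K)}
  obtain ⟨_, hT⟩ := hform.exists_mem_quotient_sInf hne hher T fun K hK => hK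
  refine hsat G (hform.mem_quotient_of_le (sInf T) (frattini G) ?_ hT)
  refine le_iInf₂ fun L hL => ?_
  rcases h L hL with h | h
  · exact (sInf_le (show A ∈ T from ⟨inferInstance, hA⟩)).trans h
  · exact sInf_le ⟨h, mem_quotient_of_isCoatom hher hG L hL⟩

theorem exists_le_isMaximalSubgroup [Finite G] {H : Subgroup G} (hH : 𝔉.Mem H) :
    ∃ M : Subgroup G, H ≤ M ∧ 𝔉.IsMaximalSubgroup M :=
  Finite.exists_le_maximal (p := fun H : Subgroup G => 𝔉.Mem H) hH

theorem IsMaximalSubgroup.map_equiv {M : Subgroup G} (hM : 𝔉.IsMaximalSubgroup M)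
    (e : G ≃* G) : 𝔉.IsMaximalSubgroup (M.map (e : G →* G)) := by
  refine ⟨𝔉.mem_of_mulEquiv (e.subgroupMap M) hM.prop, fun K hK hle => ?_⟩
  have h1 : M ≤ K.map (e.symm : G →* G) := by
    rw [← Subgroup.comap_equiv_eq_map_symm]
    exact Subgroup.map_le_iff_le_comap.mp hle
  have h2 := hM.le_of_ge (𝔉.mem_of_mulEquiv (e.symm.subgroupMap K) hK) h1
  rw [← Subgroup.comap_equiv_eq_map_symm] at h2
  intro x hx
  refine ⟨e.symm x, h2 ?_, e.apply_symm_apply x⟩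
  simpa using hx

theorem normalizerInter_le (M : Subgroup G) (hM : 𝔉.IsMaximalSubgroup M) :
    𝔉.normalizerInter G ≤ Subgroup.normalizer (M : Set G) :=
  iInf₂_le M hM

theorem maxInter_le (M : Subgroup G) (hM : 𝔉.IsMaximalSubgroup M) : 𝔉.maxInter G ≤ M :=
  iInf₂_le M hM

theorem maxInter_le_normalizerInter : 𝔉.maxInter G ≤ 𝔉.normalizerInter G :=
  iInf₂_mono fun _ _ => Subgroup.le_normalizer

instance normal_normalizerInter : (𝔉.normalizerInter G).Normal := by
  refine ⟨fun x hx g => ?_⟩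
  simp only [normalizerInter, Subgroup.mem_iInf]
  intro M hM
  have h := normalizerInter_le _ (hM.map_equiv (MulAut.conj g⁻¹)) hx
  have h2 : M = (M.map (MulAut.conj g⁻¹ : G ≃* G).toMonoidHom).map (MulAut.conj g).toMonoidHom := by
    ext y
    simp [Subgroup.mem_map, mul_assoc]
  rw [h2, ← Subgroup.map_equiv_normalizer_eq]
  exact ⟨x, h, by simp⟩

instance normal_maxInter_subgroupOf :
    ((𝔉.maxInter G).subgroupOf (𝔉.normalizerInter G)).Normal := by
  refine ⟨fun x hx g => ?_⟩
  rw [Subgroup.mem_subgroupOf] at hx ⊢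
  simp only [maxInter, Subgroup.mem_iInf]
  intro M hM
  exact (Subgroup.mem_normalizer_iff.mp (normalizerInter_le M hM g.2) x).mp (maxInter_le M hM hx)

/-- A `π(𝔉)`-subgroup of `G` belongs to `𝔉` if its image modulo `NI_𝔉(G)` does. -/
theorem mem_of_map_normalizerInter (hne : ∃ (E : Type u) (_ : Group E), 𝔉.Mem E)
    (hform : 𝔉.IsFormation) (hher : 𝔉.IsHereditary) (hsat : 𝔉.IsSaturated) [Finite G]
    (S : Subgroup G) (hS : IsPiGroup 𝔉.primes S)
    (hmap : 𝔉.Mem (S.map (QuotientGroup.mk' (𝔉.normalizerInter G)))) : 𝔉.Mem S := by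
  induction S using WellFoundedLT.induction with
  | ind S ih =>
  by_contra hnot
  set N := 𝔉.normalizerInter G
  have hA : 𝔉.Mem (S ⧸ N.subgroupOf S) := by
    have hker : ((QuotientGroup.mk' N).subgroupMap S).ker = N.subgroupOf S := by
      ext x
      rw [MonoidHom.mem_ker, Subtype.ext_iff]
      exact QuotientGroup.eq_one_iff (x : G)
    refine 𝔉.mem_of_mulEquiv ?_ hmap
    exact (QuotientGroup.quotientKerEquivOfSurjective _
      ((QuotientGroup.mk' N).subgroupMap_surjective S)).symm.trans
      (QuotientGroup.quotientMulEquivOfEq hker)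
  refine hnot (mem_of_forall_isCoatom hne hform hher hsat hS (N.subgroupOf S) hA fun L hL => ?_)
  have hlt : L.map S.subtype < S :=
    lt_of_lt_of_le ((Subgroup.map_lt_map_iff_of_injective S.subtype_injective).mpr hL.lt_top)
      (Subgroup.map_subtype_le ⊤)
  obtain ⟨M, hLM, hM⟩ := exists_le_isMaximalSubgroup
    (ih _ hlt (hS.mono hlt.le) (hher.mem_of_le (Subgroup.map_mono hlt.le) hmap))
  have hLeq : M.subgroupOf S = L := by
    rcases hL.le_iff.mp (Subgroup.map_le_iff_le_comap.mp hLM) with h | h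
    · exact absurd (hher.mem_of_le (Subgroup.subgroupOf_eq_top.mp h) hM.prop) hnot
    · exact h
  have hnorm : N.subgroupOf S ≤ Subgroup.normalizer (L : Set S) := by
    intro x hx
    rw [Subgroup.mem_normalizer_iff]
    intro y
    rw [← hLeq]
    exact Subgroup.mem_normalizer_iff.mp (normalizerInter_le M hM hx) y
  rcases hL.le_iff.mp (Subgroup.le_normalizer (H := L)) with h | h
  · exact Or.inr (Subgroup.normalizer_eq_top_iff.mp h)
  · exact Or.inl (hnorm.trans h.le)

/-- For `p ∈ π(𝔉)`, every `p`-subgroup `P` of `NI_𝔉(G)` lies in every `𝔉`-maximal subgroup `M`,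
because the product `M P` belongs to `𝔉`. -/
theorem le_maxInter_of_isPGroup (hne : ∃ (E : Type u) (_ : Group E), 𝔉.Mem E)
    (hform : 𝔉.IsFormation) (hher : 𝔉.IsHereditary) (hsat : 𝔉.IsSaturated) [Finite G]
    {p : ℕ} (hp : p ∈ 𝔉.primes) {P : Subgroup G} (hP : IsPGroup p P)
    (hPN : P ≤ 𝔉.normalizerInter G) : P ≤ 𝔉.maxInter G := by
  refine le_iInf₂ fun M hM => ?_
  have : Fact p.Prime := ⟨hp.1⟩
  have hpi : IsPiGroup 𝔉.primes (M ⊔ P : Subgroup G) := by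
    intro q hq hd
    rcases hq.dvd_mul.mp (hd.trans (Subgroup.card_sup_dvd_of_le_normalizer
      (hPN.trans (normalizerInter_le M hM)))) with h | h
    · exact ⟨hq, M, inferInstance, hM.prop, h⟩
    · obtain ⟨n, hn⟩ := IsPGroup.iff_card.mp hP
      rw [hn] at h
      rwa [(Nat.prime_dvd_prime_iff_eq hq hp.1).mp (hq.dvd_of_dvd_pow h)]
  have hmap : 𝔉.Mem ((M ⊔ P).map (QuotientGroup.mk' (𝔉.normalizerInter G))) := by
    have hbot : P.map (QuotientGroup.mk' (𝔉.normalizerInter G)) = ⊥ := by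
      rwa [Subgroup.map_eq_bot_iff, QuotientGroup.ker_mk']
    rw [Subgroup.map_sup, hbot, sup_bot_eq]
    exact hform.mem_map _ hM.prop
  exact le_sup_right.trans
    (hM.le_of_ge (mem_of_map_normalizerInter hne hform hher hsat _ hpi hmap) le_sup_left)

theorem isPiGroup_normalizerInter_quotient (hne : ∃ (E : Type u) (_ : Group E), 𝔉.Mem E)
    (hform : 𝔉.IsFormation) (hher : 𝔉.IsHereditary) (hsat : 𝔉.IsSaturated) [Finite G] :
    IsPiGroup (primeCompl 𝔉.primes)
      (𝔉.normalizerInter G ⧸ (𝔉.maxInter G).subgroupOf (𝔉.normalizerInter G)) := by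
  refine fun p hp hd => ⟨hp, fun hpi => ?_⟩
  have : Fact p.Prime := ⟨hp⟩
  let P : Sylow p (𝔉.normalizerInter G) := default
  have hle : (P : Subgroup (𝔉.normalizerInter G)) ≤
      (𝔉.maxInter G).subgroupOf (𝔉.normalizerInter G) :=
    Subgroup.map_le_iff_le_comap.mp <| le_maxInter_of_isPGroup hne hform hher hsat hpi
      (P.isPGroup'.map (𝔉.normalizerInter G).subtype) (Subgroup.map_subtype_le _)
  exact P.not_dvd_index (hd.trans (Subgroup.index_dvd_of_le hle))

theorem isPiGroup_maxInter (hne : ∃ (E : Type u) (_ : Group E), 𝔉.Mem E)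
    (hher : 𝔉.IsHereditary) [Finite G] : IsPiGroup 𝔉.primes (𝔉.maxInter G) := by
  obtain ⟨M, -, hM⟩ := exists_le_isMaximalSubgroup
    (mem_of_subsingleton hne hher : 𝔉.Mem (⊥ : Subgroup G))
  exact IsPiGroup.mono (maxInter_le M hM) fun p hp hd => ⟨hp, M, inferInstance, hM.prop, hd⟩

end FiniteGroupClass

/-- The image of a `π`-subgroup in a `π'`-quotient is trivial. -/
theorem le_piResidual_primeCompl {π : Set ℕ} {G : Type u} [Group G] [Finite G] {H : Subgroup G}
    (hH : IsPiGroup π H) : H ≤ piResidual (primeCompl π) G := by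
  obtain ⟨_, hR⟩ := (isLeast_piResidual (primeCompl π) G).1
  intro x hx
  rw [← QuotientGroup.eq_one_iff, ← orderOf_eq_one_iff]
  by_contra hne
  obtain ⟨p, hp, hd⟩ := Nat.exists_prime_and_dvd hne
  refine (hR p hp (hd.trans (orderOf_dvd_natCard _))).2 (hH p hp ?_)
  exact (hd.trans (orderOf_map_dvd (QuotientGroup.mk' (piResidual (primeCompl π) G)) x)).trans
    (Subgroup.orderOf_dvd_natCard H hx)

theorem proposition1 (𝔉 : FiniteGroupClass.{u})
    (hne : ∃ (E : Type u) (_ : Group E), 𝔉.Mem E)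
    (hform : 𝔉.IsFormation) (hher : 𝔉.IsHereditary) (hsat : 𝔉.IsSaturated)
    (G : Type u) [Group G] [Finite G] :
    (piResidual (primeCompl 𝔉.primes) (𝔉.normalizerInter G)).map (𝔉.normalizerInter G).subtype
        = 𝔉.maxInter G ∧
      (𝔉.primes = {p : ℕ | p.Prime} → 𝔉.normalizerInter G = 𝔉.maxInter G) := by
  have hIN := 𝔉.maxInter_le_normalizerInter (G := G)
  have hpi : IsPiGroup 𝔉.primes ((𝔉.maxInter G).subgroupOf (𝔉.normalizerInter G)) := by
    intro p hp hd
    rw [Nat.card_congr (Subgroup.subgroupOfEquivOfLe hIN).toEquiv] at hd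
    exact FiniteGroupClass.isPiGroup_maxInter hne hher p hp hd
  have hquot := FiniteGroupClass.isPiGroup_normalizerInter_quotient (G := G) hne hform hher hsat
  refine ⟨?_, fun hall => ?_⟩
  · rw [le_antisymm ((isLeast_piResidual _ _).2 ⟨inferInstance, hquot⟩)
      (le_piResidual_primeCompl hpi), Subgroup.map_subgroupOf_eq_of_le hIN]
  · -- No prime divides the index of `Int_𝔉(G)` in `NI_𝔉(G)`.
    refine le_antisymm (Subgroup.relIndex_eq_one.mp ?_) hIN
    by_contra h
    obtain ⟨p, hp, hd⟩ := Nat.exists_prime_and_dvd h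
    exact (hquot p hp hd).2 (hall ▸ hp)
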